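/- For a nonzero polynomial $P\in\mathbb{C}[x]$ let $$m_3(P)=\int_0^1 \log^3\bigl|P(e^{2\pi i\theta})\bigr|\,d\theta ,$$ and for an integer $\ell\ge 2$ and $t\in\mathbb{R}$ let $$C_\ell(t)=\sum_{m=1}^\infty\frac{\cos(mt)}{m^\ell},\qquad S_\ell(t)=\sum_{m=1}^\infty\frac{\sin(mt)}{m^\ell}$$ be the Clausen functions. Let $P(x)=\prod_{j=1}^n(x-e^{2\pi i\alpha_j})$ with real numbers $0\le\alpha_1\le\dots\le\alpha_n<1$. Then the integral defining $m_3(P)$ converges absolutely, and $$m_3(P)=-\frac32 n^2\zeta(3)-3n\sum_{1\le k<l\le n}C_3\bigl(2\pi(\alpha_l-\alpha_k)\bigr)-3\pi\sum_{1\le k<l\le n}S_2\bigl(2\pi(\alpha_l-\alpha_k)\bigr)\bigl(n(\alpha_l-\alpha_k)-(l-k)\bigr).$$ -/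

import Mathlib

/-- The `k`-higher Mahler measure of a (nonzero) complex polynomial `P`:
`m_k(P) = ∫₀¹ log^k |P(e^{2πiθ})| dθ`. -/
noncomputable def higherMahlerMeasure (k : ℕ) (P : Polynomial ℂ) : ℝ :=
  ∫ θ in (0 : ℝ)..1, (Real.log ‖P.eval (Complex.exp (2 * Real.pi * Complex.I * θ))‖) ^ k

/-- The Clausen cosine function `C_ℓ(t) = ∑_{m ≥ 1} cos (m t) / m ^ ℓ`
(absolutely convergent for `ℓ ≥ 2`). -/
noncomputable def clausenC (l : ℕ) (t : ℝ) : ℝ :=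
  ∑' m : ℕ, Real.cos (((m : ℝ) + 1) * t) / ((m : ℝ) + 1) ^ l

/-- The Clausen sine function `S_ℓ(t) = ∑_{m ≥ 1} sin (m t) / m ^ ℓ`
(absolutely convergent for `ℓ ≥ 2`). -/
noncomputable def clausenS (l : ℕ) (t : ℝ) : ℝ :=
  ∑' m : ℕ, Real.sin (((m : ℝ) + 1) * t) / ((m : ℝ) + 1) ^ l

/-!
Write `e θ = exp (2πiθ)`, and let `F θ = ∑ j, log (1 - e (θ - α j)) = u θ + i v θ` be the boundary
values of a function that is analytic in the unit disc and vanishes at the origin. Then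
`u = log |P (e θ)|`, while `v` is a sum of sawtooth functions `ψ j = π (fract (θ - α j) - 1 / 2)`.

* The mean value property for `F ^ 3`, transported to the unit circle by dominated convergence,
  gives `∫ F ^ 3 = 0`, hence `∫ u ^ 3 = 3 ∫ u v ^ 2` (`integral_sumLog_re_pow_three`).
* The difference of two sawtooth functions takes two values only, so it satisfies a quadratic
  equation, and `ψ b * ψ c` is a combination of `ψ b ^ 2`, `ψ c ^ 2`, `ψ b - ψ c` and a constant
  (`sawtooth_mul_sawtooth`). This reduces `∫ u v ^ 2` to the integrals of `log |1 - e θ|` against a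
  translate of the sawtooth function or of its square.
* These two integrals are `-S₂ / 2` and `-C₃ / 2` (`integral_re_mul_im`, `integral_re_mul_im_sq`):
  since `log (1 - z)` has no negative Fourier modes on the circle, the Fourier coefficients of
  `log |1 - e θ|` follow from those of the sawtooth function (`integral_re_mul_cos_sub`). The square
  of the sawtooth function has an absolutely convergent Fourier series; the sawtooth function itself
  is handled by Abel summation.
* In the sum over all triples of roots, `C₃` enters through pairs with multiplicity `n`, and `S₂`
  with the sum of the weights `±π / 2` and `π (α b - α c)`, which is affine in `α b` and in the rank
  of `b` (`sum_sawtoothWeight`). The branch of a weight is chosen by the order of the indices, so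
  repeated roots need no separate treatment.
-/

namespace HigherMahler

open MeasureTheory Filter Topology Complex

/-! ### Logarithm of `1 - z` on the unit circle: bounds, integrability, mean value property -/

/-- The point `exp (2πix)` of the unit circle. -/
noncomputable def e (x : ℝ) : ℂ := Complex.exp (2 * Real.pi * Complex.I * x)

/-- The principal logarithm of `1 - z` at `z = r * e x`. For `r = 1` its real part is
`log |1 - e x|` and its imaginary part is the sawtooth function `π (fract x - 1 / 2)`, except at
integers `x`, where both are zero. -/
noncomputable def circleLog (r x : ℝ) : ℂ := Complex.log (1 - r * e x)

lemma e_eq_exp_mul_I (x : ℝ) : e x = Complex.exp ((2 * Real.pi * x : ℝ) * Complex.I) := by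
  unfold e; push_cast; ring_nf

@[simp] lemma norm_e (x : ℝ) : ‖e x‖ = 1 := by
  rw [e_eq_exp_mul_I, Complex.norm_exp_ofReal_mul_I]

lemma e_add (x y : ℝ) : e (x + y) = e x * e y := by
  unfold e; rw [← Complex.exp_add]; push_cast; ring_nf

@[simp] lemma e_zero : e 0 = 1 := by simp [e]

lemma e_eq_one_iff (x : ℝ) : e x = 1 ↔ ∃ n : ℤ, x = n := by
  have h2 : (2 * Real.pi * Complex.I : ℂ) ≠ 0 := Complex.two_pi_I_ne_zero
  rw [e, Complex.exp_eq_one_iff]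
  refine exists_congr fun n => ?_
  rw [mul_comm (n : ℂ), mul_right_inj' h2]
  norm_cast

lemma e_nat_mul (m : ℕ) (x : ℝ) : e (m * x) = e x ^ m := by
  unfold e; rw [← Complex.exp_nat_mul]; push_cast; ring_nf

@[fun_prop] lemma continuous_e : Continuous e := by unfold e; fun_prop

lemma e_periodic : Function.Periodic e 1 := fun x => by
  rw [e_add, (e_eq_one_iff 1).2 ⟨1, by simp⟩, mul_one]

lemma circleLog_periodic (r : ℝ) : Function.Periodic (circleLog r) 1 := fun x => by
  rw [circleLog, e_periodic, circleLog]

@[fun_prop] lemma measurable_circleLog (r : ℝ) : Measurable (circleLog r) := by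
  unfold circleLog; fun_prop

/-- Translating by `a`, the point `e (θ - a)` avoids the singularity `1` for almost every `θ`. -/
lemma ae_e_sub_ne_one (a : ℝ) : ∀ᵐ θ : ℝ, e (θ - a) ≠ 1 := by
  have hc : (Set.range fun n : ℤ => (n : ℝ) + a).Countable := Set.countable_range _
  filter_upwards [hc.ae_notMem volume] with θ hθ h
  obtain ⟨n, hn⟩ := (e_eq_one_iff _).1 h
  exact hθ ⟨n, by simp [← hn]⟩

lemma e_re_lt_one {x : ℝ} (h : e x ≠ 1) : (e x).re < 1 := by
  have h1 : (e x).re ≤ 1 := (norm_e x) ▸ Complex.re_le_norm (e x)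
  refine lt_of_le_of_ne h1 fun h2 => h ?_
  have h3 : (e x).re ^ 2 + (e x).im ^ 2 = 1 := by
    have := Complex.sq_norm (e x)
    rw [norm_e, Complex.normSq_apply] at this
    nlinarith
  apply Complex.ext
  · simpa using h2
  · rw [h2] at h3
    simpa using h3

lemma one_sub_re_pos {r x : ℝ} (hr0 : 0 ≤ r) (hr1 : r ≤ 1) (h : e x ≠ 1) :
    0 < (1 - r * e x).re := by
  have := e_re_lt_one h
  simp only [Complex.sub_re, Complex.one_re, Complex.re_ofReal_mul]
  rcases hr0.eq_or_lt with rfl | h0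
  · simp
  · nlinarith

lemma one_sub_re_pos_of_norm_lt {z : ℂ} (h : ‖z‖ < 1) : 0 < (1 - z).re := by
  have := Complex.re_le_norm z
  simp only [Complex.sub_re, Complex.one_re]
  linarith

lemma tendsto_circleLog {x : ℝ} (h : e x ≠ 1) :
    Tendsto (fun r : ℝ => circleLog r x) (𝓝[<] 1) (𝓝 (circleLog 1 x)) := by
  have h1 : ContinuousAt (fun r : ℝ => circleLog r x) 1 := by
    unfold circleLog
    refine ContinuousAt.clog (by fun_prop) (Or.inl ?_)
    exact one_sub_re_pos zero_le_one le_rfl h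
  exact h1.mono_left nhdsWithin_le_nhds

lemma abs_circleLog_im_le (r x : ℝ) : |(circleLog r x).im| ≤ Real.pi := by
  rw [circleLog, Complex.log_im]; exact Complex.abs_arg_le_pi _

/-- The radial values are dominated by the boundary value, uniformly in the radius. -/
lemma norm_circleLog_le {r x : ℝ} (hr0 : 0 ≤ r) (hr1 : r ≤ 1) (h : e x ≠ 1) :
    ‖circleLog r x‖ ≤ ‖circleLog 1 x‖ + (Real.log 2 + Real.pi) := by
  have h1 : 0 < ‖1 - e x‖ := norm_pos_iff.2 (sub_ne_zero.2 (Ne.symm h))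
  have hd : ‖e x - r * e x‖ = 1 - r := by
    have : e x - r * e x = ((1 - r : ℝ) : ℂ) * e x := by push_cast; ring
    rw [this, norm_mul, norm_e, mul_one, Complex.norm_real, Real.norm_of_nonneg (by linarith)]
  have hlow : 1 - r ≤ ‖1 - r * e x‖ := by
    have := norm_sub_norm_le (1 : ℂ) (r * e x)
    rw [norm_mul, norm_e, Complex.norm_real, Real.norm_of_nonneg hr0] at this
    simpa using this
  have h2 : ‖1 - e x‖ ≤ 2 * ‖1 - r * e x‖ := by
    have := norm_sub_le (1 - r * e x) (e x - r * e x)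
    rw [hd, show (1 - r * e x) - (e x - r * e x) = 1 - e x by ring] at this
    linarith
  have h3 : ‖1 - r * e x‖ ≤ 2 := by
    have := norm_sub_le (1 : ℂ) (r * e x)
    rw [norm_mul, norm_e, Complex.norm_real, Real.norm_of_nonneg hr0] at this
    simp only [norm_one] at this
    linarith
  have h4 : 0 < ‖1 - r * e x‖ := by linarith
  have hl2 : 0 < Real.log 2 := Real.log_pos (by norm_num)
  have hre : |(circleLog r x).re| ≤ ‖circleLog 1 x‖ + Real.log 2 := by
    have h5 : |(circleLog 1 x).re| ≤ ‖circleLog 1 x‖ := Complex.abs_re_le_norm _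
    simp only [circleLog, Complex.log_re, Complex.ofReal_one, one_mul] at h5 ⊢
    have h6 : Real.log ‖1 - r * e x‖ ≤ Real.log 2 := Real.log_le_log h4 h3
    have h7 : Real.log ‖1 - e x‖ ≤ Real.log 2 + Real.log ‖1 - r * e x‖ := by
      rw [← Real.log_mul (by norm_num) h4.ne']
      exact Real.log_le_log h1 h2
    have h8 := abs_le.1 h5
    rw [abs_le]
    constructor <;> linarith [norm_nonneg (Complex.log (1 - e x))]
  have := Complex.norm_le_abs_re_add_abs_im (circleLog r x)
  linarith [abs_circleLog_im_le r x]

/-- The polar form of `1 - e x`; its modulus is `2 sin (π x)` for `0 < x < 1`. -/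
lemma one_sub_e (x : ℝ) :
    1 - e x = ((2 * Real.sin (Real.pi * x) : ℝ) : ℂ) *
      Complex.exp ((Real.pi * (x - 1 / 2) : ℝ) * Complex.I) := by
  have h1 : ((Real.pi * (x - 1 / 2) : ℝ) : ℂ) * Complex.I
      = (Real.pi * x : ℂ) * Complex.I + -(Real.pi / 2 * Complex.I) := by push_cast; ring
  have h2 : e x = Complex.exp ((Real.pi * x : ℂ) * Complex.I) ^ 2 := by
    rw [e, ← Complex.exp_nat_mul]; push_cast; ring_nf
  rw [h1, Complex.exp_add, Complex.exp_neg, Complex.exp_pi_div_two_mul_I, Complex.inv_I, h2]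
  have h3 : Complex.exp (-(Real.pi * x : ℂ) * Complex.I) * Complex.exp ((Real.pi * x : ℂ) * Complex.I)
      = 1 := by
    rw [← Complex.exp_add]; simp
  push_cast
  rw [Complex.sin]
  linear_combination -h3 + (Complex.exp (-(Real.pi * x : ℂ) * Complex.I) *
    Complex.exp ((Real.pi * x : ℂ) * Complex.I) - Complex.exp ((Real.pi * x : ℂ) * Complex.I) ^ 2)
    * Complex.I_sq

lemma sin_pi_mul_pos {x : ℝ} (hx : x ∈ Set.Ioo (0 : ℝ) 1) : 0 < Real.sin (Real.pi * x) :=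
  Real.sin_pos_of_pos_of_lt_pi (mul_pos Real.pi_pos hx.1) (by nlinarith [Real.pi_pos, hx.2])

lemma circleLog_one_eq {x : ℝ} (hx : x ∈ Set.Ioo (0 : ℝ) 1) :
    circleLog 1 x = (Real.log (2 * Real.sin (Real.pi * x)) : ℝ) +
      (Real.pi * (x - 1 / 2) : ℝ) * Complex.I := by
  have hs := sin_pi_mul_pos hx
  rw [circleLog, Complex.ofReal_one, one_mul, one_sub_e,
    Complex.log_ofReal_mul (by positivity) (Complex.exp_ne_zero _), Complex.log_exp]
  · simp only [Complex.mul_im, Complex.ofReal_re, Complex.I_im, Complex.ofReal_im, Complex.I_re]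
    nlinarith [Real.pi_pos, hx.1]
  · simp only [Complex.mul_im, Complex.ofReal_re, Complex.I_im, Complex.ofReal_im, Complex.I_re]
    nlinarith [Real.pi_pos, hx.2]

lemma circleLog_one_im {x : ℝ} (hx : x ∈ Set.Ioo (0 : ℝ) 1) :
    (circleLog 1 x).im = Real.pi * (x - 1 / 2) := by
  rw [circleLog_one_eq hx]; simp

lemma mul_one_sub_le_sin {x : ℝ} (hx : x ∈ Set.Ioo (0 : ℝ) 1) :
    x * (1 - x) ≤ Real.sin (Real.pi * x) := by
  have hpi := Real.pi_pos
  obtain ⟨h0, h1⟩ := hx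
  rcases le_total x (1 / 2) with h | h
  · have := Real.mul_le_sin (x := Real.pi * x) (by positivity) (by nlinarith)
    rw [show 2 / Real.pi * (Real.pi * x) = 2 * x by field_simp] at this
    nlinarith
  · have := Real.mul_le_sin (x := Real.pi * (1 - x)) (by nlinarith) (by nlinarith)
    rw [show 2 / Real.pi * (Real.pi * (1 - x)) = 2 * (1 - x) by field_simp,
      show Real.pi * (1 - x) = Real.pi - Real.pi * x by ring, Real.sin_pi_sub] at this
    nlinarith

lemma norm_circleLog_one_le {x : ℝ} (hx : x ∈ Set.Ioo (0 : ℝ) 1) :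
    ‖circleLog 1 x‖ ≤ (Real.log 2 + Real.pi) - Real.log x - Real.log (1 - x) := by
  have h := Complex.norm_le_abs_re_add_abs_im (circleLog 1 x)
  have h2 := abs_circleLog_im_le 1 x
  have hs := sin_pi_mul_pos hx
  have h3 : (circleLog 1 x).re = Real.log 2 + Real.log (Real.sin (Real.pi * x)) := by
    rw [circleLog_one_eq hx, Real.log_mul (by norm_num) hs.ne']
    simp only [Complex.add_re, Complex.ofReal_re, Complex.re_ofReal_mul, Complex.I_re, mul_zero,
      add_zero]
  have h4 : Real.log x + Real.log (1 - x) ≤ Real.log (Real.sin (Real.pi * x)) := by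
    rw [← Real.log_mul hx.1.ne' (by linarith [hx.2])]
    exact Real.log_le_log (mul_pos hx.1 (by linarith [hx.2])) (mul_one_sub_le_sin hx)
  have h5 : Real.log (Real.sin (Real.pi * x)) ≤ 0 := Real.log_nonpos hs.le (Real.sin_le_one _)
  have h6 : |(circleLog 1 x).re| ≤ Real.log 2 - Real.log x - Real.log (1 - x) := by
    have : 0 < Real.log 2 := Real.log_pos (by norm_num)
    rw [h3, abs_le]; constructor <;> linarith
  linarith

@[fun_prop] lemma measurable_circleLog_sub (r a : ℝ) : Measurable fun θ => circleLog r (θ - a) :=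
  (measurable_circleLog r).comp (measurable_id.sub_const a)

/-- Lebesgue measure on one period `(0, 1]`. -/
noncomputable abbrev unitMeasure : Measure ℝ := volume.restrict (Set.Ioc 0 1)

/-- Cubic integrability of the logarithm at `0`, from `|log x| ≤ 6 x ^ (-1 / 6)`. -/
lemma memLp_log : MemLp Real.log 3 unitMeasure := by
  rw [← integrable_norm_rpow_iff Real.measurable_log.aestronglyMeasurable (by norm_num) (by norm_num)]
  have h1 : Integrable (fun x : ℝ => 216 * x ^ (-(1 / 2) : ℝ)) unitMeasure :=
    ((intervalIntegrable_iff_integrableOn_Ioc_of_le zero_le_one).1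
      (intervalIntegral.intervalIntegrable_rpow' (by norm_num))).const_mul _
  refine h1.mono' (Real.measurable_log.norm.pow_const _).aestronglyMeasurable ?_
  filter_upwards [ae_restrict_mem measurableSet_Ioc] with x hx
  have h2 := (Real.abs_log_mul_self_rpow_lt x (1 / 6) hx.1 hx.2 (by norm_num)).le
  have hp : 0 < x ^ (1 / 6 : ℝ) := Real.rpow_pos_of_pos hx.1 _
  rw [abs_mul, abs_of_pos hp] at h2
  have h3 : (|Real.log x| * x ^ (1 / 6 : ℝ)) ^ 3 ≤ 6 ^ 3 :=
    pow_le_pow_left₀ (by positivity) (by linarith) 3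
  rw [mul_pow, ← Real.rpow_natCast (x ^ (1 / 6 : ℝ)), ← Real.rpow_mul hx.1.le] at h3
  norm_num at h3
  rw [Real.rpow_neg hx.1.le, ← div_eq_mul_inv, le_div_iff₀ (Real.rpow_pos_of_pos hx.1 _)]
  simpa using h3

lemma memLp_log_one_sub : MemLp (fun x : ℝ => Real.log (1 - x)) 3 unitMeasure := by
  have hm : MeasurePreserving (fun x : ℝ => 1 - x) unitMeasure (volume.restrict (Set.Ico 0 1)) := by
    have := (Measure.measurePreserving_sub_left (volume : Measure ℝ) 1).restrict_preimage
      (measurableSet_Ico (a := (0:ℝ)) (b := 1))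
    simpa using this
  refine MemLp.comp_measurePreserving (g := Real.log) ?_ hm
  rw [restrict_Ico_eq_restrict_Ioc]
  exact memLp_log

lemma ae_mem_Ioo : ∀ᵐ x ∂unitMeasure, x ∈ Set.Ioo (0 : ℝ) 1 := by
  rw [unitMeasure, ← restrict_Ioo_eq_restrict_Ioc]
  exact ae_restrict_mem measurableSet_Ioo

lemma memLp_circleLog_one : MemLp (circleLog 1) 3 unitMeasure := by
  have h : MemLp (fun x : ℝ => (Real.log 2 + Real.pi) - Real.log x - Real.log (1 - x)) 3
      unitMeasure := ((memLp_const (Real.log 2 + Real.pi)).sub memLp_log).sub memLp_log_one_sub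
  refine MemLp.of_le h (measurable_circleLog 1).aestronglyMeasurable ?_
  filter_upwards [ae_mem_Ioo] with x hx
  exact (norm_circleLog_one_le hx).trans (Real.le_norm_self _)

/-- Cubic integrability over a full period is invariant under translation. -/
lemma memLp_circleLog (a : ℝ) : MemLp (fun θ => circleLog 1 (θ - a)) 3 unitMeasure := by
  rw [← integrable_norm_rpow_iff (measurable_circleLog_sub 1 a).aestronglyMeasurable (by norm_num) (by norm_num)]
  have h := memLp_circleLog_one.integrable_norm_rpow (by norm_num) (by norm_num)
  have hi : IntervalIntegrable (fun x => ‖circleLog 1 x‖ ^ (3 : ENNReal).toReal) volume 0 1 :=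
    (intervalIntegrable_iff_integrableOn_Ioc_of_le zero_le_one).2 h
  have hp : Function.Periodic (fun x => ‖circleLog 1 x‖ ^ (3 : ENNReal).toReal) 1 := fun x => by
    simp only [circleLog_periodic 1 x]
  have h2 := (hp.intervalIntegrable (t := 0) one_ne_zero (by simpa using hi) (0 - a) (1 - a)).comp_sub_right a
  have h3 := (intervalIntegrable_iff_integrableOn_Ioc_of_le (by simp)).1 h2
  simpa [IntegrableOn] using h3

/-- The mean value property on the unit circle, for functions that are analytic only in the open
disc and have dominated radial limits. -/
lemma integral_boundary {g : ℂ → ℂ} (hg : DifferentiableOn ℂ g (Metric.ball 0 1)) {h : ℝ → ℂ}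
    {G : ℝ → ℝ} (hG : Integrable G unitMeasure)
    (bound : ∀ r : ℝ, 0 ≤ r → r < 1 → ∀ᵐ θ : ℝ, ‖g (r * e θ)‖ ≤ G θ)
    (lim : ∀ᵐ θ : ℝ, Tendsto (fun r : ℝ => g (r * e θ)) (𝓝[<] 1) (𝓝 (h θ))) :
    ∫ θ, h θ ∂unitMeasure = g 0 := by
  have hev : ∀ᶠ r : ℝ in 𝓝[<] 1, 0 ≤ r ∧ r < 1 := by
    filter_upwards [Ioo_mem_nhdsLT (zero_lt_one (α := ℝ))] with r hr using ⟨hr.1.le, hr.2⟩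
  have hmem : ∀ r : ℝ, 0 ≤ r → r < 1 → ∀ θ, (r * e θ : ℂ) ∈ Metric.ball (0 : ℂ) 1 := by
    intro r h0 h1 θ
    simpa [abs_of_nonneg h0] using h1
  have hmean : ∀ r : ℝ, 0 ≤ r → r < 1 → ∫ θ, g (r * e θ) ∂unitMeasure = g 0 := by
    intro r h0 h1
    have hd : DiffContOnCl ℂ g (Metric.ball 0 |r|) := by
      refine (hg.mono ?_).diffContOnCl
      refine Metric.closure_ball_subset_closedBall.trans ?_
      exact Metric.closedBall_subset_ball (by rwa [abs_of_nonneg h0])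
    have hc := hd.circleAverage
    rw [Real.circleAverage_def] at hc
    rw [← intervalIntegral.integral_of_le zero_le_one, ← hc]
    have := intervalIntegral.integral_comp_mul_left (a := 0) (b := 1)
      (fun θ => g (circleMap 0 r θ)) (c := 2 * Real.pi) (by positivity)
    rw [mul_zero, mul_one] at this
    rw [← this]
    simp only [circleMap, e_eq_exp_mul_I, zero_add]
  have ht : Tendsto (fun r : ℝ => ∫ θ, g (r * e θ) ∂unitMeasure) (𝓝[<] 1)
      (𝓝 (∫ θ, h θ ∂unitMeasure)) := by
    refine tendsto_integral_filter_of_dominated_convergence G ?_ ?_ hG (ae_restrict_of_ae lim)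
    · filter_upwards [hev] with r hr
      have : Continuous fun θ : ℝ => g (r * e θ) :=
        hg.continuousOn.comp_continuous (by fun_prop) (hmem r hr.1 hr.2)
      exact this.aestronglyMeasurable
    · filter_upwards [hev] with r hr using ae_restrict_of_ae (bound r hr.1 hr.2)
  refine tendsto_nhds_unique ht (tendsto_const_nhds.congr' ?_)
  filter_upwards [hev] with r hr using (hmean r hr.1 hr.2).symm

/-! ### Fourier coefficients of `log |1 - z|` -/

lemma integrable_circleLog (a : ℝ) : Integrable (fun θ => circleLog 1 (θ - a)) unitMeasure :=
  (memLp_circleLog a).integrable (by norm_num)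

lemma integrable_circleLog_one : Integrable (circleLog 1) unitMeasure :=
  memLp_circleLog_one.integrable (by norm_num)

lemma differentiableOn_log_one_sub_mul {w : ℂ} (hw : ‖w‖ = 1) :
    DifferentiableOn ℂ (fun z => Complex.log (1 - z * w)) (Metric.ball 0 1) := by
  refine DifferentiableOn.clog (by fun_prop) fun z hz => Or.inl ?_
  refine one_sub_re_pos_of_norm_lt ?_
  rw [norm_mul, hw, mul_one]
  simpa using hz

/-- The boundary values of `z ^ m * log (1 - z)` have mean zero: the negative Fourier modes of
`log (1 - z)` and its constant term vanish. -/
lemma integral_circleLog_mul_e (m : ℕ) : ∫ θ, circleLog 1 θ * e (m * θ) ∂unitMeasure = 0 := by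
  have hd : DifferentiableOn ℂ (fun z : ℂ => Complex.log (1 - z) * z ^ m) (Metric.ball 0 1) := by
    have := differentiableOn_log_one_sub_mul (w := 1) (by simp)
    simp only [mul_one] at this
    exact this.mul (by fun_prop)
  have hb : ∀ᵐ θ : ℝ, e θ ≠ 1 := by simpa using ae_e_sub_ne_one 0
  have h := integral_boundary hd (h := fun θ => circleLog 1 θ * e (m * θ))
    (G := fun θ => ‖circleLog 1 θ‖ + (Real.log 2 + Real.pi))
    (integrable_circleLog_one.norm.add (integrable_const _)) ?_ ?_
  · simpa using h
  · intro r h0 h1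
    filter_upwards [hb] with θ hθ
    have h2 := norm_circleLog_le h0 h1.le hθ
    rw [norm_mul, norm_pow, norm_mul, norm_e, mul_one, Complex.norm_real, Real.norm_of_nonneg h0]
    exact (mul_le_of_le_one_right (norm_nonneg _) (pow_le_one₀ h0 h1.le)).trans h2
  · filter_upwards [hb] with θ hθ
    have h2 : Tendsto (fun r : ℝ => (r * e θ : ℂ) ^ m) (𝓝[<] 1) (𝓝 (e (m * θ))) := by
      have h3 : Continuous fun r : ℝ => (r * e θ : ℂ) ^ m := by fun_prop
      have h4 := (h3.tendsto 1).mono_left (nhdsWithin_le_nhds (s := Set.Iio 1))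
      simpa [e_nat_mul] using h4
    exact (tendsto_circleLog hθ).mul h2

lemma integral_sawtooth_mul_sin_add (m : ℕ) (φ : ℝ) :
    ∫ θ, (circleLog 1 θ).im * Real.sin (2 * Real.pi * (m + 1) * θ + φ) ∂unitMeasure
      = -(Real.cos φ / (2 * (m + 1))) := by
  have hpi := Real.pi_pos
  have hm : (m : ℝ) + 1 ≠ 0 := by positivity
  obtain ⟨w, hw⟩ : ∃ w : ℝ, w = 2 * Real.pi * (m + 1) := ⟨_, rfl⟩
  have hw0 : w ≠ 0 := by rw [hw]; positivity
  have hwn : w = (m + 1 : ℕ) * (2 * Real.pi) := by rw [hw]; push_cast; ring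
  have h1 : ∫ θ, (circleLog 1 θ).im * Real.sin (w * θ + φ) ∂unitMeasure
      = ∫ θ in (0:ℝ)..1, Real.pi * (θ - 1 / 2) * Real.sin (w * θ + φ) := by
    rw [intervalIntegral.integral_of_le zero_le_one]
    refine integral_congr_ae ?_
    filter_upwards [ae_mem_Ioo] with θ hθ
    rw [circleLog_one_im hθ]
  rw [← hw, h1, intervalIntegral.integral_eq_sub_of_hasDerivAt (f := fun x =>
    -(Real.pi * (x - 1 / 2) * Real.cos (w * x + φ)) / w + Real.pi * Real.sin (w * x + φ) / w ^ 2)]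
  · have hc : Real.cos (w + φ) = Real.cos φ := by
      rw [hwn, add_comm, Real.cos_add_nat_mul_two_pi]
    have hs : Real.sin (w + φ) = Real.sin φ := by
      rw [hwn, add_comm, Real.sin_add_nat_mul_two_pi]
    simp only [mul_one, mul_zero, zero_add, hc, hs]
    rw [hw]
    field_simp
    ring
  · intro x _
    have hx : HasDerivAt (fun x : ℝ => w * x + φ) w x := by
      simpa using ((hasDerivAt_id x).const_mul w).add_const φ
    have hl : HasDerivAt (fun x : ℝ => Real.pi * (x - 1 / 2)) Real.pi x := by
      simpa only [id, mul_one] using ((hasDerivAt_id x).sub_const (1 / 2)).const_mul Real.pi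
    refine (((hl.mul hx.cos).neg.div_const w).add
      ((hx.sin.const_mul Real.pi).div_const (w ^ 2))).congr_deriv ?_
    field_simp
    ring
  · exact (by fun_prop : Continuous _).intervalIntegrable _ _

lemma integral_sawtooth_mul_sin (m : ℕ) :
    ∫ θ, (circleLog 1 θ).im * Real.sin (2 * Real.pi * (m + 1) * θ) ∂unitMeasure
      = -(1 / (2 * (m + 1))) := by
  simpa only [add_zero, Real.cos_zero] using integral_sawtooth_mul_sin_add m 0

lemma integral_sawtooth_mul_cos (m : ℕ) :
    ∫ θ, (circleLog 1 θ).im * Real.cos (2 * Real.pi * (m + 1) * θ) ∂unitMeasure = 0 := by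
  simpa only [Real.sin_add_pi_div_two, Real.cos_pi_div_two, zero_div, neg_zero] using
    integral_sawtooth_mul_sin_add m (Real.pi / 2)

lemma integrable_re_mul {f : ℝ → ℝ} {a C : ℝ} (hf : Measurable f) (hC : ∀ θ, |f θ| ≤ C) :
    Integrable (fun θ => (circleLog 1 (θ - a)).re * f θ) unitMeasure :=
  (integrable_circleLog a).re.mul_bdd hf.aestronglyMeasurable (ae_of_all _ hC)

lemma integrable_im_mul {f : ℝ → ℝ} {a C : ℝ} (hf : Measurable f) (hC : ∀ θ, |f θ| ≤ C) :
    Integrable (fun θ => (circleLog 1 (θ - a)).im * f θ) unitMeasure :=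
  (integrable_circleLog a).im.mul_bdd hf.aestronglyMeasurable (ae_of_all _ hC)

lemma e_natCast_mul (m : ℕ) (θ : ℝ) : e ((m + 1 : ℕ) * θ) =
    (Real.cos (2 * Real.pi * (m + 1) * θ) : ℝ) + (Real.sin (2 * Real.pi * (m + 1) * θ) : ℝ) * I := by
  rw [e_eq_exp_mul_I, Complex.exp_mul_I, Complex.ofReal_cos, Complex.ofReal_sin]
  push_cast
  ring_nf

/-- The Fourier coefficients of `log |1 - e θ|`, with an arbitrary phase `φ`. -/
lemma integral_re_mul_cos_sub (m : ℕ) (φ : ℝ) :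
    ∫ θ, (circleLog 1 θ).re * Real.cos (2 * Real.pi * (m + 1) * θ - φ) ∂unitMeasure
      = -(Real.cos φ / (2 * (m + 1))) := by
  set c : ℝ → ℝ := fun θ => Real.cos (2 * Real.pi * (m + 1) * θ) with hc
  set s : ℝ → ℝ := fun θ => Real.sin (2 * Real.pi * (m + 1) * θ) with hs
  have hcm : Measurable c := by fun_prop
  have hsm : Measurable s := by fun_prop
  have hcb : ∀ θ, |c θ| ≤ 1 := fun θ => Real.abs_cos_le_one _
  have hsb : ∀ θ, |s θ| ≤ 1 := fun θ => Real.abs_sin_le_one _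
  have i1 := integrable_re_mul (a := 0) hcm hcb
  have i2 := integrable_re_mul (a := 0) hsm hsb
  have i3 := integrable_im_mul (a := 0) hcm hcb
  have i4 := integrable_im_mul (a := 0) hsm hsb
  simp only [sub_zero] at i1 i2 i3 i4
  have h0 := integral_circleLog_mul_e (m + 1)
  have hdec : ∀ θ, circleLog 1 θ * e ((m + 1 : ℕ) * θ)
      = (((circleLog 1 θ).re * c θ - (circleLog 1 θ).im * s θ : ℝ) : ℂ)
        + (((circleLog 1 θ).re * s θ + (circleLog 1 θ).im * c θ : ℝ) : ℂ) * I := by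
    intro θ
    rw [e_natCast_mul]
    apply Complex.ext <;> simp [c, s, -Complex.ofReal_cos, -Complex.ofReal_sin]
  simp_rw [hdec] at h0
  -- the sine and cosine integrals of the sawtooth determine those of `log |1 - e θ|`
  rw [integral_add (i1.sub i4).ofReal ((i2.add i3).ofReal.mul_const _), integral_mul_const,
    integral_complex_ofReal, integral_complex_ofReal, integral_sub i1 i4, integral_add i2 i3,
    hs, hc, integral_sawtooth_mul_sin, integral_sawtooth_mul_cos] at h0
  have hre := congrArg Complex.re h0
  have him := congrArg Complex.im h0
  simp only [Complex.add_re, Complex.add_im, Complex.ofReal_re, Complex.ofReal_im,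
    Complex.re_ofReal_mul, Complex.im_ofReal_mul, Complex.I_re, Complex.I_im, Complex.zero_re,
    Complex.zero_im, mul_zero, mul_one, add_zero, zero_add] at hre him
  have hcos : ∀ θ, (circleLog 1 θ).re * Real.cos (2 * Real.pi * (m + 1) * θ - φ)
      = (circleLog 1 θ).re * c θ * Real.cos φ + (circleLog 1 θ).re * s θ * Real.sin φ := by
    intro θ; rw [Real.cos_sub]; ring
  simp_rw [hcos]
  rw [integral_add (i1.mul_const _) (i2.mul_const _), integral_mul_const, integral_mul_const,
    hs, hc, him, eq_neg_of_add_eq_zero_left (by linarith [hre] :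
      (∫ θ, (circleLog 1 θ).re * Real.cos (2 * Real.pi * (m + 1) * θ) ∂unitMeasure)
        + 1 / (2 * ((m : ℝ) + 1)) = 0)]
  ring

lemma integral_circleLog_one_re : ∫ θ, (circleLog 1 θ).re ∂unitMeasure = 0 := by
  have h := integral_circleLog_mul_e 0
  simp only [CharP.cast_eq_zero, zero_mul, e_zero, mul_one] at h
  have h2 := _root_.integral_re integrable_circleLog_one
  rw [h] at h2
  simpa using h2

/-- Termwise integration of an absolutely convergent cosine series against `log |1 - e θ|`. -/
lemma hasSum_integral_re_mul {c φ : ℕ → ℝ} (hc : Summable fun n => |c n|) {S : ℝ → ℝ}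
    (hS : ∀ᵐ θ : ℝ, HasSum (fun n => c n * Real.cos (2 * Real.pi * (n + 1) * θ - φ n)) (S θ)) :
    HasSum (fun n : ℕ => c n * -(Real.cos (φ n) / (2 * (n + 1))))
      (∫ θ, (circleLog 1 θ).re * S θ ∂unitMeasure) := by
  have hL := integrable_circleLog_one.re
  have h := hasSum_integral_of_dominated_convergence (μ := unitMeasure)
    (F := fun (n : ℕ) θ => (circleLog 1 θ).re * (c n * Real.cos (2 * Real.pi * (n + 1) * θ - φ n)))
    (f := fun θ => (circleLog 1 θ).re * S θ) (fun n θ => |(circleLog 1 θ).re| * |c n|)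
    ?_ ?_ ?_ ?_ ?_
  · have hcoef : ∀ n : ℕ, c n * -(Real.cos (φ n) / (2 * (n + 1))) = ∫ θ, (circleLog 1 θ).re *
        (c n * Real.cos (2 * Real.pi * (n + 1) * θ - φ n)) ∂unitMeasure := by
      intro n
      rw [← integral_re_mul_cos_sub, ← integral_const_mul]
      congr 1; ext θ; ring
    simpa only [hcoef] using h
  · intro n
    have : Measurable fun θ => circleLog 1 θ := measurable_circleLog 1
    exact (by fun_prop : Measurable _).aestronglyMeasurable
  · intro n
    refine ae_of_all _ fun θ => ?_
    rw [norm_mul, norm_mul]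
    refine mul_le_mul_of_nonneg_left ?_ (norm_nonneg _)
    exact mul_le_of_le_one_right (norm_nonneg _) (Real.abs_cos_le_one _)
  · exact ae_of_all _ fun θ => hc.mul_left _
  · simp_rw [tsum_mul_left]
    exact hL.norm.mul_const _
  · exact ae_restrict_of_ae (hS.mono fun θ h => h.mul_left _)

/-! ### Correlations of `log |1 - z|` with the sawtooth function and its square -/

lemma circleLog_one_im_eq_fract {x : ℝ} (h : e x ≠ 1) :
    (circleLog 1 x).im = Real.pi * (Int.fract x - 1 / 2) := by
  have hf : Int.fract x ≠ 0 := by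
    intro h0
    obtain ⟨n, hn⟩ := Int.fract_eq_zero_iff.1 h0
    exact h ((e_eq_one_iff x).2 ⟨n, hn.symm⟩)
  have hper : circleLog 1 (Int.fract x) = circleLog 1 x := by
    have := (circleLog_periodic 1).sub_int_mul_eq ⌊x⌋ (x := x)
    rwa [mul_one] at this
  rw [← hper]
  exact circleLog_one_im ⟨lt_of_le_of_ne (Int.fract_nonneg x) hf.symm, Int.fract_lt_one x⟩

/-- The Fourier series of the square of the sawtooth function, a second Bernoulli polynomial up to
a constant. -/
lemma hasSum_sawtooth_sq {x : ℝ} (h : e x ≠ 1) :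
    HasSum (fun n : ℕ => 1 / ((n : ℝ) + 1) ^ 2 * Real.cos (2 * Real.pi * (n + 1) * x))
      ((circleLog 1 x).im ^ 2 - Real.pi ^ 2 / 12) := by
  have h1 := hasSum_one_div_nat_pow_mul_cos one_ne_zero (x := Int.fract x)
    ⟨Int.fract_nonneg x, (Int.fract_lt_one x).le⟩
  rw [← hasSum_nat_add_iff' 1] at h1
  convert! h1 using 1
  · ext n
    congr 1
    · push_cast; ring
    · have : 2 * Real.pi * ((n + 1 : ℕ) : ℝ) * Int.fract x
          = 2 * Real.pi * (n + 1) * x - (((n + 1 : ℕ) * ⌊x⌋ : ℤ) : ℝ) * (2 * Real.pi) := by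
        rw [← Int.self_sub_floor]; push_cast; ring
      rw [this, Real.cos_sub_int_mul_two_pi]
  · rw [circleLog_one_im_eq_fract h]
    simp [Polynomial.bernoulli, Finset.sum_range_succ, bernoulli, bernoulli'_two]
    ring

lemma summable_one_div_succ_sq : Summable fun n : ℕ => 1 / ((n : ℝ) + 1) ^ 2 := by
  have := (summable_nat_add_iff 1).2 (Real.summable_one_div_nat_pow.2 one_lt_two)
  simpa using this

lemma integral_re_mul_im_sq (t : ℝ) :
    ∫ θ, (circleLog 1 θ).re * (circleLog 1 (θ - t)).im ^ 2 ∂unitMeasure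
      = -(1 / 2) * clausenC 3 (2 * Real.pi * t) := by
  have hS : ∀ᵐ θ : ℝ, HasSum (fun n : ℕ => 1 / ((n : ℝ) + 1) ^ 2 *
      Real.cos (2 * Real.pi * (n + 1) * θ - 2 * Real.pi * (n + 1) * t))
      ((circleLog 1 (θ - t)).im ^ 2 - Real.pi ^ 2 / 12) := by
    filter_upwards [ae_e_sub_ne_one t] with θ hθ
    convert hasSum_sawtooth_sq hθ using 4
    ring
  have h := hasSum_integral_re_mul (c := fun n : ℕ => 1 / ((n : ℝ) + 1) ^ 2)
    (by simpa using summable_one_div_succ_sq) hS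
  have hm : Measurable fun θ => (circleLog 1 (θ - t)).im ^ 2 := by fun_prop
  have hb : ∀ θ, |(circleLog 1 (θ - t)).im ^ 2| ≤ Real.pi ^ 2 := fun θ => by
    rw [abs_pow]; exact pow_le_pow_left₀ (abs_nonneg _) (abs_circleLog_im_le _ _) 2
  have hi := integrable_re_mul (a := 0) hm hb
  simp only [sub_zero] at hi
  have hsub : ∫ θ, (circleLog 1 θ).re * ((circleLog 1 (θ - t)).im ^ 2 - Real.pi ^ 2 / 12)
      ∂unitMeasure = ∫ θ, (circleLog 1 θ).re * (circleLog 1 (θ - t)).im ^ 2 ∂unitMeasure := by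
    simp_rw [mul_sub]
    have hL : Integrable (fun θ => (circleLog 1 θ).re) unitMeasure := integrable_circleLog_one.re
    rw [integral_sub hi (hL.mul_const _), integral_mul_const, integral_circleLog_one_re, zero_mul,
      sub_zero]
  rw [← hsub, ← h.tsum_eq, clausenC, ← tsum_mul_left]
  refine tsum_congr fun n => ?_
  rw [show 2 * Real.pi * ((n : ℝ) + 1) * t = ((n : ℝ) + 1) * (2 * Real.pi * t) by ring]
  have : (n : ℝ) + 1 ≠ 0 := by positivity
  field_simp

/-- The Fourier series of the sawtooth function with Abel factors `r ^ m`. For `r < 1` it converges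
absolutely, which it does not for `r = 1`. -/
lemma hasSum_circleLog_im {r : ℝ} (hr0 : 0 ≤ r) (hr1 : r < 1) (x : ℝ) :
    HasSum (fun n : ℕ => -(r ^ (n + 1) / (n + 1)) * Real.sin (2 * Real.pi * (n + 1) * x))
      (circleLog r x).im := by
  have h1 : ‖(r * e x : ℂ)‖ < 1 := by simpa [abs_of_nonneg hr0] using hr1
  have h2 := Complex.hasSum_taylorSeries_neg_log h1
  rw [← hasSum_nat_add_iff' 1] at h2
  have h3 := (Complex.hasSum_im h2).neg
  convert! h3 using 1
  · ext n
    rw [mul_pow, ← e_nat_mul, e_natCast_mul]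
    have : (r : ℂ) ^ (n + 1) * ((Real.cos (2 * Real.pi * (n + 1) * x) : ℝ) +
        (Real.sin (2 * Real.pi * (n + 1) * x) : ℝ) * I) / ((n + 1 : ℕ) : ℂ)
        = ((r ^ (n + 1) / (n + 1) : ℝ) : ℂ) * ((Real.cos (2 * Real.pi * (n + 1) * x) : ℝ) +
        (Real.sin (2 * Real.pi * (n + 1) * x) : ℝ) * I) := by
      push_cast; ring
    rw [this, Complex.im_ofReal_mul, Complex.add_im, Complex.ofReal_im, Complex.im_ofReal_mul,
      Complex.I_im]
    ring
  · simp [circleLog]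

lemma integral_re_mul_radial_im {r : ℝ} (hr0 : 0 ≤ r) (hr1 : r < 1) (t : ℝ) :
    ∫ θ, (circleLog 1 θ).re * (circleLog r (θ - t)).im ∂unitMeasure
      = ∑' n : ℕ, -(1 / 2) * (r ^ (n + 1) *
          (Real.sin (((n : ℝ) + 1) * (2 * Real.pi * t)) / ((n : ℝ) + 1) ^ 2)) := by
  have hc : Summable fun n : ℕ => |-(r ^ (n + 1) / ((n : ℝ) + 1))| := by
    refine Summable.of_nonneg_of_le (fun _ => abs_nonneg _) (fun n => ?_)
      (summable_geometric_of_lt_one hr0 hr1)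
    rw [abs_neg, abs_of_nonneg (by positivity)]
    have h1 : r ^ (n + 1) ≤ r ^ n := pow_le_pow_of_le_one hr0 hr1.le (Nat.le_succ n)
    exact (div_le_self (by positivity) (by linarith [n.cast_nonneg (α := ℝ)])).trans h1
  have h := hasSum_integral_re_mul hc (S := fun θ => (circleLog r (θ - t)).im)
    (φ := fun n => 2 * Real.pi * (n + 1) * t + Real.pi / 2)
    (ae_of_all _ fun θ => by
      convert hasSum_circleLog_im hr0 hr1 (θ - t) using 3 with n
      rw [← sub_sub, Real.cos_sub_pi_div_two, mul_sub])
  rw [← h.tsum_eq]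
  refine tsum_congr fun n => ?_
  rw [Real.cos_add_pi_div_two,
    show 2 * Real.pi * ((n : ℝ) + 1) * t = ((n : ℝ) + 1) * (2 * Real.pi * t) by ring]
  have : (n : ℝ) + 1 ≠ 0 := by positivity
  field_simp

/-- The correlation with the sawtooth function, as the limit of its Abel means. -/
lemma integral_re_mul_im (t : ℝ) :
    ∫ θ, (circleLog 1 θ).re * (circleLog 1 (θ - t)).im ∂unitMeasure
      = -(1 / 2) * clausenS 2 (2 * Real.pi * t) := by
  have hev : ∀ᶠ r : ℝ in 𝓝[<] 1, 0 ≤ r ∧ r < 1 := by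
    filter_upwards [Ioo_mem_nhdsLT (zero_lt_one (α := ℝ))] with r hr using ⟨hr.1.le, hr.2⟩
  have hleft : Tendsto (fun r : ℝ =>
      ∫ θ, (circleLog 1 θ).re * (circleLog r (θ - t)).im ∂unitMeasure) (𝓝[<] 1)
      (𝓝 (∫ θ, (circleLog 1 θ).re * (circleLog 1 (θ - t)).im ∂unitMeasure)) := by
    refine tendsto_integral_filter_of_dominated_convergence
      (fun θ => |(circleLog 1 θ).re| * Real.pi) ?_ ?_ ?_ ?_
    · refine Eventually.of_forall fun r => ?_
      have h1 := measurable_circleLog 1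
      have h2 := measurable_circleLog_sub r t
      exact ((Complex.measurable_re.comp h1).mul
        (Complex.measurable_im.comp h2)).aestronglyMeasurable
    · refine Eventually.of_forall fun r => ae_of_all _ fun θ => ?_
      rw [norm_mul]
      exact mul_le_mul_of_nonneg_left (abs_circleLog_im_le _ _) (norm_nonneg _)
    · exact integrable_circleLog_one.re.norm.mul_const _
    · refine ae_restrict_of_ae ?_
      filter_upwards [ae_e_sub_ne_one t] with θ hθ
      exact ((Complex.continuous_im.tendsto _).comp (tendsto_circleLog hθ)).const_mul _
  have hright : Tendsto (fun r : ℝ => ∑' n : ℕ, -(1 / 2) * (r ^ (n + 1) *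
          (Real.sin (((n : ℝ) + 1) * (2 * Real.pi * t)) / ((n : ℝ) + 1) ^ 2))) (𝓝[<] 1)
      (𝓝 (∑' n : ℕ, -(1 / 2) * (1 ^ (n + 1) *
          (Real.sin (((n : ℝ) + 1) * (2 * Real.pi * t)) / ((n : ℝ) + 1) ^ 2)))) := by
    refine tendsto_tsum_of_dominated_convergence summable_one_div_succ_sq (fun n => ?_) ?_
    · exact ((by fun_prop : Continuous fun r : ℝ => -(1 / 2) * (r ^ (n + 1) *
          (Real.sin (((n : ℝ) + 1) * (2 * Real.pi * t)) / ((n : ℝ) + 1) ^ 2))).tendsto 1).mono_left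
        nhdsWithin_le_nhds
    · filter_upwards [hev] with r hr n
      rw [norm_mul, norm_mul, norm_div, norm_pow, norm_pow, Real.norm_of_nonneg hr.1,
        Real.norm_of_nonneg (by positivity : (0 : ℝ) ≤ n + 1)]
      have h1 : r ^ (n + 1) ≤ 1 := pow_le_one₀ hr.1 hr.2.le
      have h2 : ‖Real.sin (((n : ℝ) + 1) * (2 * Real.pi * t))‖ / ((n : ℝ) + 1) ^ 2
          ≤ 1 / ((n : ℝ) + 1) ^ 2 :=
        div_le_div_of_nonneg_right (Real.abs_sin_le_one _) (by positivity)
      have h3 : ‖-(1 / 2 : ℝ)‖ ≤ 1 := by norm_num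
      have h4 : 0 ≤ r ^ (n + 1) := pow_nonneg hr.1 _
      calc _ ≤ 1 * (1 * (1 / ((n : ℝ) + 1) ^ 2)) := by gcongr
        _ = _ := by ring
  have heq := tendsto_nhds_unique hleft (hright.congr' (by
    filter_upwards [hev] with r hr using (integral_re_mul_radial_im hr.1 hr.2 t).symm))
  rw [heq, clausenS, ← tsum_mul_left]
  simp

lemma integral_unit_comp_sub {f : ℝ → ℝ} (hf : Function.Periodic f 1) (a : ℝ) :
    ∫ θ, f (θ - a) ∂unitMeasure = ∫ θ, f θ ∂unitMeasure := by
  rw [← intervalIntegral.integral_of_le zero_le_one, ← intervalIntegral.integral_of_le zero_le_one,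
    intervalIntegral.integral_comp_sub_right]
  have := hf.intervalIntegral_add_eq (0 - a) 0
  rw [zero_add] at this
  rw [← this]
  congr 1; ring

lemma integral_re_sub_mul_im_sub (a b : ℝ) :
    ∫ θ, (circleLog 1 (θ - a)).re * (circleLog 1 (θ - b)).im ∂unitMeasure
      = -(1 / 2) * clausenS 2 (2 * Real.pi * (b - a)) := by
  rw [← integral_re_mul_im, ← integral_unit_comp_sub (a := a)
    (f := fun θ => (circleLog 1 θ).re * (circleLog 1 (θ - (b - a))).im)]
  · congr 1; ext θ; rw [show θ - a - (b - a) = θ - b by ring]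
  · intro θ
    beta_reduce
    rw [add_sub_right_comm, circleLog_periodic, circleLog_periodic]

lemma integral_re_sub_mul_im_sub_sq (a b : ℝ) :
    ∫ θ, (circleLog 1 (θ - a)).re * (circleLog 1 (θ - b)).im ^ 2 ∂unitMeasure
      = -(1 / 2) * clausenC 3 (2 * Real.pi * (b - a)) := by
  rw [← integral_re_mul_im_sq, ← integral_unit_comp_sub (a := a)
    (f := fun θ => (circleLog 1 θ).re * (circleLog 1 (θ - (b - a))).im ^ 2)]
  · congr 1; ext θ; rw [show θ - a - (b - a) = θ - b by ring]
  · intro θ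
    beta_reduce
    rw [add_sub_right_comm, circleLog_periodic, circleLog_periodic]

/-- For `0 ≤ b - c < 1`, the difference of the two sawtooth functions takes only two values, so that
its square is an affine function of it. Hence the product of two sawtooth functions is a combination
of squares, single sawtooth functions and a constant. -/
lemma sawtooth_mul_sawtooth {b c θ : ℝ} (h0 : c ≤ b) (h1 : b - c < 1)
    (hb : e (θ - b) ≠ 1) (hc : e (θ - c) ≠ 1) :
    (circleLog 1 (θ - b)).im * (circleLog 1 (θ - c)).im =
      1 / 2 * ((circleLog 1 (θ - b)).im ^ 2 + (circleLog 1 (θ - c)).im ^ 2) +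
      Real.pi * ((b - c) - 1 / 2) * ((circleLog 1 (θ - b)).im - (circleLog 1 (θ - c)).im) -
      Real.pi ^ 2 / 2 * ((b - c) * (1 - (b - c))) := by
  rw [circleLog_one_im_eq_fract hb, circleLog_one_im_eq_fract hc]
  have hx0 := Int.fract_nonneg (θ - b)
  have hx1 := Int.fract_lt_one (θ - b)
  have hy0 := Int.fract_nonneg (θ - c)
  have hy1 := Int.fract_lt_one (θ - c)
  have hxy : Int.fract (θ - c) - Int.fract (θ - b) = (b - c) + ((⌊θ - b⌋ - ⌊θ - c⌋ : ℤ) : ℝ) := by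
    rw [← Int.self_sub_floor, ← Int.self_sub_floor]; push_cast; ring
  -- the difference of the floors is an integer in `(-2, 1)`
  have hk1 : (⌊θ - b⌋ - ⌊θ - c⌋ : ℤ) < 1 := by
    have : ((⌊θ - b⌋ - ⌊θ - c⌋ : ℤ) : ℝ) < 1 := by linarith
    exact_mod_cast this
  have hk2 : -2 < (⌊θ - b⌋ - ⌊θ - c⌋ : ℤ) := by
    have : (-2 : ℝ) < ((⌊θ - b⌋ - ⌊θ - c⌋ : ℤ) : ℝ) := by linarith
    exact_mod_cast this
  generalize (⌊θ - b⌋ - ⌊θ - c⌋ : ℤ) = k at hxy hk1 hk2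
  have hy : Int.fract (θ - c) = Int.fract (θ - b) + (b - c) + k := by linarith
  rw [hy]
  have hk : k = 0 ∨ k = -1 := by omega
  rcases hk with rfl | rfl <;> push_cast <;> ring

/-! ### Sums over all pairs and triples of roots -/

section

variable {n : ℕ} (α : Fin n → ℝ)

/-- The boundary values of `∑ j, log (1 - z * e (-α j))`, which is analytic in the disc and vanishes
at the origin. Almost everywhere, its real part is `log |P|` for the monic polynomial `P` with roots
`e (α j)`. -/
noncomputable def sumLog (θ : ℝ) : ℂ := ∑ j, circleLog 1 (θ - α j)

lemma memLp_sumLog : MemLp (sumLog α) 3 unitMeasure :=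
  memLp_finsetSum _ fun j _ => memLp_circleLog (α j)

lemma sumLog_re (θ : ℝ) : (sumLog α θ).re = ∑ j, (circleLog 1 (θ - α j)).re := by
  rw [sumLog, Complex.re_sum]

lemma sumLog_im (θ : ℝ) : (sumLog α θ).im = ∑ j, (circleLog 1 (θ - α j)).im := by
  rw [sumLog, Complex.im_sum]

lemma integral_sumLog_pow_three : ∫ θ, sumLog α θ ^ 3 ∂unitMeasure = 0 := by
  have hd : DifferentiableOn ℂ (fun z : ℂ => (∑ j, Complex.log (1 - z * e (-α j))) ^ 3)
      (Metric.ball 0 1) := by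
    refine DifferentiableOn.pow ?_ 3
    exact DifferentiableOn.fun_sum fun j _ => differentiableOn_log_one_sub_mul (norm_e _)
  have heq : ∀ (r θ : ℝ), (∑ j, Complex.log (1 - (r * e θ) * e (-α j)))
      = ∑ j, circleLog r (θ - α j) := by
    intro r θ
    refine Finset.sum_congr rfl fun j _ => ?_
    rw [circleLog, sub_eq_add_neg θ, e_add, mul_assoc]
  have hae : ∀ᵐ θ : ℝ, ∀ j, e (θ - α j) ≠ 1 := ae_all_iff.2 fun j => ae_e_sub_ne_one _
  have hG : MemLp (fun θ => ∑ j, (‖circleLog 1 (θ - α j)‖ + (Real.log 2 + Real.pi))) 3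
      unitMeasure :=
    memLp_finsetSum _ fun j _ => (memLp_circleLog (α j)).norm.add (memLp_const _)
  have h := integral_boundary hd (h := fun θ => sumLog α θ ^ 3) (hG.integrable_norm_pow (p := 3)
    (by norm_num)) ?_ ?_
  · simpa using h
  · intro r h0 h1
    filter_upwards [hae] with θ hθ
    rw [heq, norm_pow]
    refine pow_le_pow_left₀ (norm_nonneg _) ?_ 3
    refine (norm_sum_le _ _).trans (le_trans ?_ (Real.le_norm_self _))
    exact Finset.sum_le_sum fun j _ => norm_circleLog_le h0 h1.le (hθ j)
  · filter_upwards [hae] with θ hθ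
    simp only [heq]
    exact (tendsto_finsetSum _ fun j _ => tendsto_circleLog (hθ j)).pow 3

lemma integrable_re_mul_im_mul_im (a b c : ℝ) :
    Integrable (fun θ => (circleLog 1 (θ - a)).re *
      ((circleLog 1 (θ - b)).im * (circleLog 1 (θ - c)).im)) unitMeasure := by
  refine integrable_re_mul (C := Real.pi * Real.pi) ?_ fun θ => ?_
  · have h1 := measurable_circleLog_sub 1 b
    have h2 := measurable_circleLog_sub 1 c
    exact (Complex.measurable_im.comp h1).mul (Complex.measurable_im.comp h2)
  · rw [abs_mul]
    exact mul_le_mul (abs_circleLog_im_le _ _) (abs_circleLog_im_le _ _) (abs_nonneg _)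
      Real.pi_pos.le

lemma re_mul_im_sq_eq_sum (θ : ℝ) : (sumLog α θ).re * (sumLog α θ).im ^ 2 =
    ∑ a, ∑ b, ∑ c, (circleLog 1 (θ - α a)).re *
      ((circleLog 1 (θ - α b)).im * (circleLog 1 (θ - α c)).im) := by
  rw [sumLog_re, sumLog_im, sq, Finset.sum_mul_sum, Finset.sum_mul]
  refine Finset.sum_congr rfl fun a _ => ?_
  rw [Finset.mul_sum]
  exact Finset.sum_congr rfl fun b _ => Finset.mul_sum _ _ _

lemma integrable_re_mul_im_sq :
    Integrable (fun θ => (sumLog α θ).re * (sumLog α θ).im ^ 2) unitMeasure := by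
  simp_rw [re_mul_im_sq_eq_sum]
  exact integrable_finsetSum _ fun a _ => integrable_finsetSum _ fun b _ =>
    integrable_finsetSum _ fun c _ => integrable_re_mul_im_mul_im _ _ _

lemma integrable_sumLog_re_pow_three :
    Integrable (fun θ => (sumLog α θ).re ^ 3) unitMeasure := by
  have h := (memLp_sumLog α).re.integrable_norm_pow (p := 3) (by norm_num)
  refine h.mono' ((memLp_sumLog α).re.aestronglyMeasurable.pow 3) (ae_of_all _ fun θ => ?_)
  exact (norm_pow _ _).le

/-- Since the boundary values of the cube of an analytic function vanishing at the origin have mean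
zero, `∫ u ^ 3 = 3 ∫ u v ^ 2` for its real part `u` and its imaginary part `v`. -/
lemma integral_sumLog_re_pow_three : ∫ θ, (sumLog α θ).re ^ 3 ∂unitMeasure =
    3 * ∫ θ, (sumLog α θ).re * (sumLog α θ).im ^ 2 ∂unitMeasure := by
  have hi : Integrable (fun θ => sumLog α θ ^ 3) unitMeasure := by
    have h := (memLp_sumLog α).integrable_norm_pow (p := 3) (by norm_num)
    refine h.mono' ((memLp_sumLog α).aestronglyMeasurable.pow 3) (ae_of_all _ fun θ => ?_)
    exact (norm_pow _ _).le
  have h := _root_.integral_re hi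
  rw [integral_sumLog_pow_three] at h
  have hpt : ∀ θ, RCLike.re (sumLog α θ ^ 3) =
      (sumLog α θ).re ^ 3 - 3 * ((sumLog α θ).re * (sumLog α θ).im ^ 2) := by
    intro θ
    simp only [pow_succ, pow_zero, one_mul, RCLike.re_to_complex, Complex.mul_re, Complex.mul_im]
    ring
  simp_rw [hpt] at h
  rw [integral_sub (integrable_sumLog_re_pow_three α) ((integrable_re_mul_im_sq α).const_mul 3),
    integral_const_mul] at h
  simp only [RCLike.re_to_complex, Complex.zero_re] at h
  linarith

/-- The coefficient in the reduction of a product of two sawtooth functions with jumps at `α b` and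
`α c`: the sawtooth function itself at `α b - α c`, where the indices (rather than the values)
decide between the two branches. -/
noncomputable def sawtoothWeight (b c : Fin n) : ℝ :=
  Real.pi * (α b - α c) - Real.pi / 2 * ((if c < b then 1 else 0) - (if b < c then 1 else 0))

lemma sawtoothWeight_swap (b c : Fin n) : sawtoothWeight α c b = -sawtoothWeight α b c := by
  unfold sawtoothWeight; ring

variable {α}

/-- The reduction formula for products of sawtooth functions, uniformly in the order of the indices.
For equal roots both sawtooth functions coincide, and the weight is irrelevant. -/
lemma exists_sawtooth_mul_sawtooth (hα0 : ∀ j, 0 ≤ α j) (hα1 : ∀ j, α j < 1) (hmono : Monotone α)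
    (b c : Fin n) : ∃ K : ℝ, ∀ θ : ℝ, e (θ - α b) ≠ 1 → e (θ - α c) ≠ 1 →
    (circleLog 1 (θ - α b)).im * (circleLog 1 (θ - α c)).im =
      1 / 2 * ((circleLog 1 (θ - α b)).im ^ 2 + (circleLog 1 (θ - α c)).im ^ 2) +
      sawtoothWeight α b c * ((circleLog 1 (θ - α b)).im - (circleLog 1 (θ - α c)).im) + K := by
  rcases lt_trichotomy b c with h | rfl | h
  · refine ⟨-(Real.pi ^ 2 / 2 * ((α c - α b) * (1 - (α c - α b)))), fun θ hb hc => ?_⟩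
    rw [mul_comm, sawtooth_mul_sawtooth (hmono h.le) (by linarith [hα0 b, hα1 c]) hc hb,
      sawtoothWeight, if_pos h, if_neg h.not_gt]
    ring
  · exact ⟨0, fun θ _ _ => by ring⟩
  · refine ⟨-(Real.pi ^ 2 / 2 * ((α b - α c) * (1 - (α b - α c)))), fun θ hb hc => ?_⟩
    rw [sawtooth_mul_sawtooth (hmono h.le) (by linarith [hα0 c, hα1 b]) hb hc,
      sawtoothWeight, if_pos h, if_neg h.not_gt]
    ring

lemma integral_re_mul_im_mul_im (hα0 : ∀ j, 0 ≤ α j) (hα1 : ∀ j, α j < 1) (hmono : Monotone α)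
    (a b c : Fin n) :
    ∫ θ, (circleLog 1 (θ - α a)).re * ((circleLog 1 (θ - α b)).im * (circleLog 1 (θ - α c)).im)
      ∂unitMeasure =
    -(1 / 4) * (clausenC 3 (2 * Real.pi * (α b - α a)) + clausenC 3 (2 * Real.pi * (α c - α a))) -
    1 / 2 * sawtoothWeight α b c *
      (clausenS 2 (2 * Real.pi * (α b - α a)) - clausenS 2 (2 * Real.pi * (α c - α a))) := by
  obtain ⟨K, hK⟩ := exists_sawtooth_mul_sawtooth hα0 hα1 hmono b c
  have hsq : ∀ x, Integrable (fun θ => (circleLog 1 (θ - α a)).re * (circleLog 1 (θ - x)).im ^ 2)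
      unitMeasure := fun x => by
    simpa only [sq] using integrable_re_mul_im_mul_im (α a) x x
  have hlin : ∀ x, Integrable (fun θ => (circleLog 1 (θ - α a)).re * (circleLog 1 (θ - x)).im)
      unitMeasure := fun x => integrable_re_mul
        (Complex.measurable_im.comp (measurable_circleLog_sub 1 x))
        fun θ => abs_circleLog_im_le _ _
  have hL : Integrable (fun θ => (circleLog 1 (θ - α a)).re) unitMeasure :=
    (integrable_circleLog _).re
  have hL0 : ∫ θ, (circleLog 1 (θ - α a)).re ∂unitMeasure = 0 := by
    rw [integral_unit_comp_sub (f := fun θ => (circleLog 1 θ).re)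
      (fun θ => by simp only [circleLog_periodic 1 θ]), integral_circleLog_one_re]
  have hcongr : ∫ θ, (circleLog 1 (θ - α a)).re *
      ((circleLog 1 (θ - α b)).im * (circleLog 1 (θ - α c)).im) ∂unitMeasure =
      ∫ θ, (1 / 2 * ((circleLog 1 (θ - α a)).re * (circleLog 1 (θ - α b)).im ^ 2 +
        (circleLog 1 (θ - α a)).re * (circleLog 1 (θ - α c)).im ^ 2) +
        sawtoothWeight α b c * ((circleLog 1 (θ - α a)).re * (circleLog 1 (θ - α b)).im -
        (circleLog 1 (θ - α a)).re * (circleLog 1 (θ - α c)).im)) +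
        K * (circleLog 1 (θ - α a)).re ∂unitMeasure := by
    refine integral_congr_ae (ae_restrict_of_ae ?_)
    filter_upwards [ae_e_sub_ne_one (α b), ae_e_sub_ne_one (α c)] with θ hb hc
    rw [hK θ hb hc]
    ring
  have i1 : Integrable (fun θ => 1 / 2 *
      ((circleLog 1 (θ - α a)).re * (circleLog 1 (θ - α b)).im ^ 2 +
        (circleLog 1 (θ - α a)).re * (circleLog 1 (θ - α c)).im ^ 2)) unitMeasure :=
    ((hsq _).add (hsq _)).const_mul _
  have i2 : Integrable (fun θ => sawtoothWeight α b c *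
      ((circleLog 1 (θ - α a)).re * (circleLog 1 (θ - α b)).im -
        (circleLog 1 (θ - α a)).re * (circleLog 1 (θ - α c)).im)) unitMeasure :=
    ((hlin _).sub (hlin _)).const_mul _
  rw [hcongr, integral_add (i1.fun_add i2) (hL.const_mul _), integral_add i1 i2,
    integral_const_mul, integral_const_mul, integral_const_mul, integral_add (hsq _) (hsq _),
    integral_sub (hlin _) (hlin _), hL0]
  simp only [integral_re_sub_mul_im_sub, integral_re_sub_mul_im_sub_sq]
  ring

variable (α)

/-- The sum of the weights is the affine expression in `α b` and in the rank of `b` that occurs in the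
formula for the Mahler measure, up to a constant independent of `b`. -/
lemma sum_sawtoothWeight (b : Fin n) : ∑ c, sawtoothWeight α b c =
    Real.pi * (n * α b - (b : ℕ)) + (Real.pi / 2 * (n - 1) - Real.pi * ∑ c, α c) := by
  have h1 : ∑ c : Fin n, (if c < b then (1 : ℝ) else 0) = (b : ℕ) := by
    rw [Finset.sum_boole, ← Fin.card_Iio b]
    congr 2; ext c; simp
  have h2 : ∑ c : Fin n, (if b < c then (1 : ℝ) else 0) = n - 1 - (b : ℕ) := by
    have h3 : ((Finset.univ.filter fun c => b < c) : Finset (Fin n)) = Finset.Ioi b := by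
      ext c; simp
    rw [Finset.sum_boole, h3, Fin.card_Ioi]
    have := b.isLt
    rw [Nat.cast_sub (by omega), Nat.cast_sub (by omega)]
    simp
  simp only [sawtoothWeight, Finset.sum_sub_distrib, ← Finset.mul_sum, h1, h2, Finset.sum_const,
    Finset.card_univ, Fintype.card_fin, nsmul_eq_mul]
  ring

lemma sum_sum_eq_sum_Ioi (f : Fin n → Fin n → ℝ) :
    ∑ a, ∑ b, f a b = ∑ a, f a a + ∑ k, ∑ l ∈ Finset.Ioi k, (f k l + f l k) := by
  have h := Finset.sum_sum_Ioi_add_eq_sum_sum_off_diag fun i j => f j i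
  simp_rw [h, ← Finset.sum_add_distrib]
  refine Finset.sum_congr rfl fun a _ => ?_
  rw [← Finset.sum_add_sum_compl {a}, Finset.sum_singleton]

lemma clausenC_neg (l : ℕ) (t : ℝ) : clausenC l (-t) = clausenC l t := by
  simp only [clausenC, mul_neg, Real.cos_neg]

lemma clausenS_neg (l : ℕ) (t : ℝ) : clausenS l (-t) = -clausenS l t := by
  simp only [clausenS, mul_neg, Real.sin_neg, neg_div, tsum_neg]

lemma clausenS_zero (l : ℕ) : clausenS l 0 = 0 := by simp [clausenS]

lemma sum_clausenC : ∑ a, ∑ b, clausenC 3 (2 * Real.pi * (α b - α a)) =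
    n * clausenC 3 0 + 2 * ∑ k, ∑ l ∈ Finset.Ioi k, clausenC 3 (2 * Real.pi * (α l - α k)) := by
  rw [sum_sum_eq_sum_Ioi, Finset.mul_sum]
  congr 1
  · simp
  · refine Finset.sum_congr rfl fun k _ => ?_
    rw [Finset.mul_sum]
    refine Finset.sum_congr rfl fun l _ => ?_
    rw [← neg_sub (α l) (α k), mul_neg, clausenC_neg]
    ring

lemma sum_clausenS_mul (V : Fin n → ℝ) :
    ∑ a, ∑ b, clausenS 2 (2 * Real.pi * (α b - α a)) * V b =
    ∑ k, ∑ l ∈ Finset.Ioi k, clausenS 2 (2 * Real.pi * (α l - α k)) * (V l - V k) := by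
  rw [sum_sum_eq_sum_Ioi]
  simp only [sub_self, mul_zero, clausenS_zero, zero_mul, Finset.sum_const_zero, zero_add]
  refine Finset.sum_congr rfl fun k _ => Finset.sum_congr rfl fun l _ => ?_
  rw [← neg_sub (α l) (α k), mul_neg, clausenS_neg]
  ring

/-- Summation over all triples; the antisymmetry of the weight merges the two Clausen sine terms. -/
lemma sum_triple (A B : Fin n → Fin n → ℝ) :
    ∑ a, ∑ b, ∑ c, (-(1 / 4) * (A a b + A a c) - 1 / 2 * sawtoothWeight α b c * (B a b - B a c)) =
    -(1 / 2) * n * ∑ a, ∑ b, A a b - ∑ a, ∑ b, B a b * ∑ c, sawtoothWeight α b c := by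
  rw [Finset.mul_sum, ← Finset.sum_sub_distrib]
  refine Finset.sum_congr rfl fun a _ => ?_
  have h1 : ∑ b, ∑ c, (A a b + A a c) = 2 * n * ∑ b, A a b := by
    simp only [Finset.sum_add_distrib, Finset.sum_const, Finset.card_univ, Fintype.card_fin,
      nsmul_eq_mul, ← Finset.mul_sum]
    ring
  have h2 : ∑ b, ∑ c, sawtoothWeight α b c * B a c = -∑ b, B a b * ∑ c, sawtoothWeight α b c := by
    rw [Finset.sum_comm, ← Finset.sum_neg_distrib]
    refine Finset.sum_congr rfl fun b _ => ?_
    rw [Finset.mul_sum, ← Finset.sum_neg_distrib]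
    refine Finset.sum_congr rfl fun c _ => ?_
    rw [sawtoothWeight_swap]; ring
  have h3 : ∑ b, ∑ c, sawtoothWeight α b c * B a b = ∑ b, B a b * ∑ c, sawtoothWeight α b c := by
    refine Finset.sum_congr rfl fun b _ => ?_
    rw [Finset.mul_sum]
    exact Finset.sum_congr rfl fun c _ => mul_comm _ _
  calc _ = -(1 / 4) * ∑ b, ∑ c, (A a b + A a c) - 1 / 2 * (∑ b, ∑ c, sawtoothWeight α b c * B a b -
        ∑ b, ∑ c, sawtoothWeight α b c * B a c) := by
        simp only [Finset.mul_sum, ← Finset.sum_sub_distrib]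
        refine Finset.sum_congr rfl fun b _ => Finset.sum_congr rfl fun c _ => ?_
        ring
    _ = _ := by rw [h1, h2, h3]; ring

variable {α}

lemma integral_sumLog_re_pow_three_eq (hα0 : ∀ j, 0 ≤ α j) (hα1 : ∀ j, α j < 1)
    (hmono : Monotone α) : ∫ θ, (sumLog α θ).re ^ 3 ∂unitMeasure =
    -(3 / 2) * n ^ 2 * clausenC 3 0
      - 3 * n * ∑ k, ∑ l ∈ Finset.Ioi k, clausenC 3 (2 * Real.pi * (α l - α k))
      - 3 * Real.pi * ∑ k, ∑ l ∈ Finset.Ioi k, clausenS 2 (2 * Real.pi * (α l - α k)) *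
        (n * (α l - α k) - (((l : ℕ) : ℝ) - ((k : ℕ) : ℝ))) := by
  have hi := fun a b c : Fin n => integrable_re_mul_im_mul_im (α a) (α b) (α c)
  rw [integral_sumLog_re_pow_three]
  simp_rw [re_mul_im_sq_eq_sum]
  rw [integral_finsetSum _ fun a _ => integrable_finsetSum _ fun b _ =>
    integrable_finsetSum _ fun c _ => hi a b c]
  have hsum : ∀ a, ∫ θ, ∑ b, ∑ c, (circleLog 1 (θ - α a)).re *
      ((circleLog 1 (θ - α b)).im * (circleLog 1 (θ - α c)).im) ∂unitMeasure =
      ∑ b, ∑ c, ∫ θ, (circleLog 1 (θ - α a)).re *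
      ((circleLog 1 (θ - α b)).im * (circleLog 1 (θ - α c)).im) ∂unitMeasure := by
    intro a
    rw [integral_finsetSum _ fun b _ => integrable_finsetSum _ fun c _ => hi a b c]
    exact Finset.sum_congr rfl fun b _ => integral_finsetSum _ fun c _ => hi a b c
  simp_rw [hsum, integral_re_mul_im_mul_im hα0 hα1 hmono]
  rw [sum_triple α (fun a b => clausenC 3 (2 * Real.pi * (α b - α a)))
    (fun a b => clausenS 2 (2 * Real.pi * (α b - α a))), sum_clausenC, sum_clausenS_mul]
  have hS : ∑ k, ∑ l ∈ Finset.Ioi k, clausenS 2 (2 * Real.pi * (α l - α k)) *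
      (∑ c, sawtoothWeight α l c - ∑ c, sawtoothWeight α k c) =
      Real.pi * ∑ k, ∑ l ∈ Finset.Ioi k, clausenS 2 (2 * Real.pi * (α l - α k)) *
        (n * (α l - α k) - (((l : ℕ) : ℝ) - ((k : ℕ) : ℝ))) := by
    simp only [Finset.mul_sum]
    refine Finset.sum_congr rfl fun k _ => Finset.sum_congr rfl fun l _ => ?_
    rw [sum_sawtoothWeight, sum_sawtoothWeight]
    ring
  rw [hS]
  ring

lemma clausenC_three_zero : ((clausenC 3 0 : ℝ) : ℂ) = riemannZeta 3 := by
  have h := zeta_nat_eq_tsum_of_gt_one (k := 3) (by norm_num)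
  have hs : Summable fun n : ℕ => (1 : ℝ) / (n : ℝ) ^ 3 :=
    Real.summable_one_div_nat_pow.2 (by norm_num)
  have h2 := hs.tsum_eq_zero_add
  have h3 : clausenC 3 0 = ∑' n : ℕ, (1 : ℝ) / (n : ℝ) ^ 3 := by
    rw [h2, clausenC]; simp
  rw [h3, Complex.ofReal_tsum]
  push_cast at h ⊢
  exact h.symm

lemma log_norm_eval_eq {θ : ℝ} (hθ : ∀ j, e (θ - α j) ≠ 1) :
    Real.log ‖(∏ j : Fin n, (Polynomial.X - Polynomial.C (Complex.exp (2 * Real.pi * Complex.I *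
      α j)))).eval (Complex.exp (2 * Real.pi * Complex.I * θ))‖ = (sumLog α θ).re := by
  have hfac : ∀ j, ‖e θ - e (α j)‖ = ‖1 - e (θ - α j)‖ := by
    intro j
    have : e θ = e (α j) * e (θ - α j) := by rw [← e_add]; congr 1; ring
    rw [this, show e (α j) * e (θ - α j) - e (α j) = -(e (α j) * (1 - e (θ - α j))) by ring,
      norm_neg, norm_mul, norm_e, one_mul]
  rw [Polynomial.eval_prod, norm_prod, sumLog_re]
  simp only [Polynomial.eval_sub, Polynomial.eval_X, Polynomial.eval_C]
  change Real.log (∏ j, ‖e θ - e (α j)‖) = _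
  simp_rw [hfac]
  rw [Real.log_prod fun j _ => norm_ne_zero_iff.2 (sub_ne_zero.2 (hθ j).symm)]
  refine Finset.sum_congr rfl fun j _ => ?_
  rw [circleLog, Complex.log_re, Complex.ofReal_one, one_mul]

end

end HigherMahler

theorem theorem1p4 (n : ℕ) (α : Fin n → ℝ) (hα0 : ∀ j, 0 ≤ α j) (hα1 : ∀ j, α j < 1)
    (hmono : Monotone α) (P : Polynomial ℂ)
    (hP : P = ∏ j : Fin n,
      (Polynomial.X - Polynomial.C (Complex.exp (2 * Real.pi * Complex.I * α j)))) :
    IntervalIntegrable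
      (fun θ : ℝ =>
        (Real.log ‖P.eval (Complex.exp (2 * Real.pi * Complex.I * θ))‖) ^ 3)
      MeasureTheory.volume 0 1 ∧
    ((higherMahlerMeasure 3 P : ℝ) : ℂ) =
      -(3 / 2) * (n : ℂ) ^ 2 * riemannZeta 3
        - ((3 * (n : ℝ) * ∑ k : Fin n, ∑ l ∈ Finset.Ioi k,
            clausenC 3 (2 * Real.pi * (α l - α k)) : ℝ) : ℂ)
        - ((3 * Real.pi * ∑ k : Fin n, ∑ l ∈ Finset.Ioi k,
            clausenS 2 (2 * Real.pi * (α l - α k)) *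
              ((n : ℝ) * (α l - α k) - (((l : ℕ) : ℝ) - ((k : ℕ) : ℝ))) : ℝ) : ℂ) := by
  subst hP
  have hae : ∀ᵐ θ : ℝ ∂HigherMahler.unitMeasure,
      (HigherMahler.sumLog α θ).re ^ 3 = (Real.log ‖(∏ j : Fin n, (Polynomial.X - Polynomial.C
        (Complex.exp (2 * Real.pi * Complex.I * α j)))).eval
        (Complex.exp (2 * Real.pi * Complex.I * θ))‖) ^ 3 := by
    refine MeasureTheory.ae_restrict_of_ae ?_
    filter_upwards [MeasureTheory.ae_all_iff.2 fun j => HigherMahler.ae_e_sub_ne_one (α j)]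
      with θ hθ
    rw [HigherMahler.log_norm_eval_eq hθ]
  refine ⟨?_, ?_⟩
  · rw [intervalIntegrable_iff_integrableOn_Ioc_of_le zero_le_one]
    exact (HigherMahler.integrable_sumLog_re_pow_three α).congr hae
  · rw [higherMahlerMeasure, intervalIntegral.integral_of_le zero_le_one,
      ← MeasureTheory.integral_congr_ae hae,
      HigherMahler.integral_sumLog_re_pow_three_eq hα0 hα1 hmono,
      ← HigherMahler.clausenC_three_zero]
    push_cast
    ring
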